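/- **Model.** A sporadic task $\tau_i$ has a worst-case execution time $C_i>0$, a period $T_i>0$ (the minimum time between two consecutive job releases) and a relative deadline $D_i>0$ (with no assumed relation to $T_i$: deadlines are arbitrary); its utilization is $U_i=C_i/T_i$. Each job of $\tau_i$ needs at most $C_i$ units of processor time, and successive jobs of the same task are executed in sequence. A finite system of sporadic tasks is scheduled on one processor by preemptive fixed-priority scheduling: every task has a priority level, and at any time at which some job is ready, a ready job of highest priority is executed. A task $\tau_k$ is schedulable if, for every legal sequence of job releases and in every resulting schedule, each job of $\tau_k$ released at a time $r$ has finished by time $r+D_k$. **Theorem.** Let $\tau_k$ be a task of such a system whose priority level is shared with no other task. Let $hp_1(\tau_k)$ be the set of tasks with higher priority than $\tau_k$ and period $T_i<D_k$, let $hp_2(\tau_k)$ be the set of tasks with higher priority than $\tau_k$ and period $T_i\ge D_k$, and put $$C_k'=\left\lceil \frac{D_k}{T_k}\right\rceil C_k+\sum_{\tau_i\in hp_2(\tau_k)}C_i .$$ Let $k^*-1$ be the number of tasks in $hp_1(\tau_k)$, and index these tasks as $\tau_1,\dots,\tau_{k^*-1}$ in a non-decreasing order of $\left(\left\lceil \frac{D_k}{T_i}\right\rceil-1\right)T_i$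 (ties broken arbitrarily). If $$\sum_{i=1}^{k^*-1}\frac{C_i}{D_k}\le 1$$ and $$\frac{C_k'}{D_k}\le 1-\sum_{i=1}^{k^*-1}U_i-\sum_{i=1}^{k^*-1}\frac{C_i}{D_k}+\frac{\sum_{i=1}^{k^*-1}U_i\left(\sum_{\ell=i}^{k^*-1}C_\ell\right)}{D_k},$$ then $\tau_k$ is schedulable. -/

import Mathlib

open MeasureTheory

/-- A sporadic real-time task: worst-case execution time `C`, period (minimum time between two
consecutive releases) `T`, and relative deadline `D`. No relation between `D` and `T` is required,
so deadlines are arbitrary. -/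
structure SporadicTask where
  C : ℝ
  T : ℝ
  D : ℝ
  C_pos : 0 < C
  T_pos : 0 < T
  D_pos : 0 < D

namespace SporadicTask

/-- The utilization of a task. -/
noncomputable def U (τ : SporadicTask) : ℝ := τ.C / τ.T

end SporadicTask

/-- A legal sequence of jobs of the task system `τ`. Task `i` releases `count i` jobs (finitely or
infinitely many), numbered from `0`; job `j` of task `i` exists if `j < count i`, is released at
time `release i j` and needs `exec i j` units of processor time, which is at most the worst-case
execution time. The values at nonexistent jobs are never used. -/
structure JobSequence {ι : Type*} (τ : ι → SporadicTask) where
  count : ι → ℕ∞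
  release : ι → ℕ → ℝ
  exec : ι → ℕ → ℝ
  exec_pos : ∀ (i : ι) (j : ℕ), (j : ℕ∞) < count i → 0 < exec i j
  exec_le : ∀ (i : ι) (j : ℕ), (j : ℕ∞) < count i → exec i j ≤ (τ i).C
  separation : ∀ (i : ι) (j : ℕ), ((j + 1 : ℕ) : ℕ∞) < count i →
    release i j + (τ i).T ≤ release i (j + 1)

namespace JobSequence

variable {ι : Type*} {τ : ι → SporadicTask}

/-- The amount of processor time that job `j` of task `i` receives from its release until time `t`
in the uniprocessor schedule `S`; `S s` is the job executed at time `s`, or `none` if the processor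
is idle at time `s`. -/
noncomputable def service (A : JobSequence τ) (S : ℝ → Option (ι × ℕ)) (i : ι) (j : ℕ) (t : ℝ) :
    ℝ :=
  volume.real ({s : ℝ | S s = some (i, j)} ∩ Set.Ico (A.release i j) t)

/-- Job `j` of task `i` has finished by time `t`. -/
def Finished (A : JobSequence τ) (S : ℝ → Option (ι × ℕ)) (i : ι) (j : ℕ) (t : ℝ) : Prop :=
  A.exec i j ≤ A.service S i j t

/-- Job `j` of task `i` is in the ready queue at time `t`: it exists, it is released, it has not
finished, and all the earlier jobs of the same task have finished (successive jobs of a task are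
executed in sequence). -/
def Ready (A : JobSequence τ) (S : ℝ → Option (ι × ℕ)) (i : ι) (j : ℕ) (t : ℝ) : Prop :=
  (j : ℕ∞) < A.count i ∧ A.release i j ≤ t ∧ ¬ A.Finished S i j t ∧
    ∀ j' : ℕ, j' < j → A.Finished S i j' t

end JobSequence

/-- `S` is a preemptive fixed-priority uniprocessor schedule of the job sequence `A`, where a
smaller value of `prio` is a higher priority: at any time, only a ready job is executed, and if
some job is ready, then a highest-priority ready job is executed. -/
structure IsFixedPrioritySchedule {ι : Type*} {τ : ι → SporadicTask} (prio : ι → ℕ)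
    (A : JobSequence τ) (S : ℝ → Option (ι × ℕ)) : Prop where
  measurable : ∀ (i : ι) (j : ℕ), MeasurableSet {s : ℝ | S s = some (i, j)}
  ready : ∀ (t : ℝ) (i : ι) (j : ℕ), S t = some (i, j) → A.Ready S i j t
  highest : ∀ (t : ℝ) (i : ι) (j : ℕ), A.Ready S i j t →
    ∃ (i' : ι) (j' : ℕ), S t = some (i', j') ∧ prio i' ≤ prio i

/-- Task `k` is schedulable by preemptive fixed-priority scheduling on a uniprocessor: whatever the
legal job sequence, each job of task `k` has finished by its absolute deadline. -/
def Schedulable {ι : Type*} (τ : ι → SporadicTask) (prio : ι → ℕ) (k : ι) : Prop :=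
  ∀ (A : JobSequence τ) (S : ℝ → Option (ι × ℕ)), IsFixedPrioritySchedule prio A S →
    ∀ j : ℕ, (j : ℕ∞) < A.count k → A.Finished S k j (A.release k j + (τ k).D)

/-- The tasks with higher priority than task `k` and with period smaller than `D_k`. -/
noncomputable def hp₁ {ι : Type*} [Fintype ι] (τ : ι → SporadicTask) (prio : ι → ℕ) (k : ι) :
    Finset ι :=
  Finset.univ.filter fun i => prio i < prio k ∧ (τ i).T < (τ k).D

/-- The tasks with higher priority than task `k` and with period at least `D_k`. -/
noncomputable def hp₂ {ι : Type*} [Fintype ι] (τ : ι → SporadicTask) (prio : ι → ℕ) (k : ι) :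
    Finset ι :=
  Finset.univ.filter fun i => prio i < prio k ∧ (τ k).D ≤ (τ i).T

/-- The execution time `C_k'` of the virtual task. -/
noncomputable def virtualC {ι : Type*} [Fintype ι] (τ : ι → SporadicTask) (prio : ι → ℕ) (k : ι) :
    ℝ :=
  (⌈(τ k).D / (τ k).T⌉ : ℝ) * (τ k).C + ∑ i ∈ hp₂ τ prio k, (τ i).C

/-- The quantity `(⌈D_k / T_i⌉ - 1) T_i`. -/
noncomputable def lastRelease {ι : Type*} (τ : ι → SporadicTask) (k i : ι) : ℝ :=
  ((⌈(τ k).D / (τ i).T⌉ : ℝ) - 1) * (τ i).T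

/-! Call an instant quiet when every earlier released job of priority at least that of `k` has
finished. If the demand of a window of some length `t ≤ D_k` is at most `t`, a quiet instant is
followed by another within `t` (`exists_next_quiet`). Starting from the last quiet instant up to a
release of `k`, the next one lies after that release and no later than its deadline, whether or not
jobs of `k` overlap (`schedulable_of_demand_le`).

If `k` is not schedulable, demand therefore exceeds supply at every `t` in `(0, D_k]`, in particular
at each `t_a = lastRelease` and at `D_k`. With `X = C_k' + ∑ U_b t_b`, this gives `t_a ≤ X + ∑_{b<a}
C_b` and `D_k < X + ∑ C_b`. Eliminating the `t_a` contradicts the quadratic test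
(`lt_of_forall_testPoint_lt`). -/

/-- The release times of existing jobs of one task are separated by multiples of the period. -/
theorem JobSequence.release_add_le {ι : Type*} {τ : ι → SporadicTask} (A : JobSequence τ) (i : ι)
    {j j' : ℕ} (h : j ≤ j') (hj' : (j' : ℕ∞) < A.count i) :
    A.release i j + ((j' : ℝ) - j) * (τ i).T ≤ A.release i j' := by
  induction j', h using Nat.le_induction with
  | base => simp
  | succ n hn ih =>
    have h1 := ih (lt_of_le_of_lt (by exact_mod_cast Nat.le_succ n) hj')
    have h2 := A.separation i n hj'
    push_cast
    linarith

theorem JobSequence.release_mono {ι : Type*} {τ : ι → SporadicTask} (A : JobSequence τ) (i : ι)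
    {j j' : ℕ} (h : j ≤ j') (hj' : (j' : ℕ∞) < A.count i) :
    A.release i j ≤ A.release i j' := by
  have h1 := A.release_add_le i h hj'
  have h2 : (0 : ℝ) ≤ (j' : ℝ) - j := sub_nonneg.2 (by exact_mod_cast h)
  have := mul_nonneg h2 (τ i).T_pos.le
  linarith

/-- At most `⌈t / T⌉` jobs of a task are released in a half-open interval of length `t`. -/
theorem JobSequence.exists_finset_released {ι : Type*} {τ : ι → SporadicTask} (A : JobSequence τ)
    (i : ι) (s t : ℝ) :
    ∃ J : Finset ℕ, (J.card : ℝ) ≤ (⌈t / (τ i).T⌉₊ : ℝ) ∧ ∀ j : ℕ, j ∈ J ↔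
      (j : ℕ∞) < A.count i ∧ s ≤ A.release i j ∧ A.release i j < s + t := by
  classical
  by_cases hne : ∃ j : ℕ, (j : ℕ∞) < A.count i ∧ s ≤ A.release i j ∧ A.release i j < s + t
  · set j₀ := Nat.find hne with hj₀
    have h₀ := Nat.find_spec hne
    refine ⟨(Finset.Ico j₀ (j₀ + ⌈t / (τ i).T⌉₊)).filter fun j =>
      (j : ℕ∞) < A.count i ∧ s ≤ A.release i j ∧ A.release i j < s + t, ?_, fun j => ?_⟩
    · refine Nat.cast_le.2 ((Finset.card_filter_le _ _).trans ?_)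
      simp
    · rw [Finset.mem_filter, Finset.mem_Ico, and_iff_right_iff_imp]
      intro h
      have h1 : j₀ ≤ j := Nat.find_min' hne h
      refine ⟨h1, ?_⟩
      have h2 := A.release_add_le i h1 h.1
      have h3 : ((j : ℝ) - j₀) < t / (τ i).T := by
        rw [lt_div_iff₀ (τ i).T_pos]
        linarith [h.2.2, h₀.2.1]
      have h4 := h3.trans_le (Nat.le_ceil _)
      have h5 : (j : ℝ) < ((j₀ + ⌈t / (τ i).T⌉₊ : ℕ) : ℝ) := by
        push_cast
        linarith
      exact_mod_cast h5
  · refine ⟨∅, by simp, fun j => ?_⟩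
    simp only [Finset.notMem_empty, false_iff]
    exact fun h => hne ⟨j, h⟩

/-! ### Service and quiet instants -/

namespace JobSequence

variable {ι : Type*} {τ : ι → SporadicTask} (A : JobSequence τ) (S : ℝ → Option (ι × ℕ))

theorem service_mono (i : ι) (j : ℕ) : Monotone (A.service S i j) := by
  intro a b hab
  refine measureReal_mono (Set.inter_subset_inter_right _ (Set.Ico_subset_Ico_right hab)) ?_
  exact ((measure_mono Set.inter_subset_right).trans_lt measure_Ico_lt_top).ne

theorem service_le_add (i : ι) (j : ℕ) {a b : ℝ} (hab : a ≤ b) :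
    A.service S i j b ≤ A.service S i j a + (b - a) := by
  have h1 : {s : ℝ | S s = some (i, j)} ∩ Set.Ico (A.release i j) b ⊆
      ({s : ℝ | S s = some (i, j)} ∩ Set.Ico (A.release i j) a) ∪ Set.Ico a b := by
    rintro x ⟨hx, hx1, hx2⟩
    rcases lt_or_ge x a with h | h
    · exact Or.inl ⟨hx, hx1, h⟩
    · exact Or.inr ⟨h, hx2⟩
  have h2 : volume (({s : ℝ | S s = some (i, j)} ∩ Set.Ico (A.release i j) a) ∪ Set.Ico a b) ≠ ⊤ :=
    measure_union_ne_top ((measure_mono Set.inter_subset_right).trans_lt measure_Ico_lt_top).ne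
      measure_Ico_lt_top.ne
  calc A.service S i j b ≤ _ := measureReal_mono h1 h2
    _ ≤ _ := measureReal_union_le _ _
    _ = A.service S i j a + (b - a) := by
      rw [Real.volume_real_Ico_of_le hab]; rfl

theorem service_continuous (i : ι) (j : ℕ) : Continuous (A.service S i j) := by
  refine (LipschitzWith.of_le_add_mul 1 fun x y => ?_).continuous
  rcases le_total x y with h | h
  · have h1 := A.service_mono S i j h
    have h2 : 0 ≤ dist x y := dist_nonneg
    simp only [NNReal.coe_one, one_mul]
    linarith
  · have h1 := A.service_le_add S i j h
    rw [Real.dist_eq, abs_of_nonneg (sub_nonneg.2 h)]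
    simpa using h1

theorem service_release (i : ι) (j : ℕ) : A.service S i j (A.release i j) = 0 := by
  simp [service]

variable {A S}

theorem Finished.mono {i : ι} {j : ℕ} {a b : ℝ} (h : A.Finished S i j a) (hab : a ≤ b) :
    A.Finished S i j b :=
  le_trans h (A.service_mono S i j hab)

/-- A released unfinished job witnesses that its task has a ready job. -/
theorem exists_ready {i : ι} {j : ℕ} {s : ℝ} (hj : (j : ℕ∞) < A.count i)
    (hr : A.release i j ≤ s) (hf : ¬ A.Finished S i j s) : ∃ j', A.Ready S i j' s := by
  classical
  have hex : ∃ n, ¬ A.Finished S i n s := ⟨j, hf⟩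
  have hle : Nat.find hex ≤ j := Nat.find_min' hex hf
  refine ⟨Nat.find hex, lt_of_le_of_lt (by exact_mod_cast hle) hj,
    (A.release_mono i hle hj).trans hr, Nat.find_spec hex, fun j' h => ?_⟩
  exact not_not.1 (Nat.find_min hex h)

/-- All jobs of the tasks in `L` released before `s` have finished by time `s`. -/
def Quiet (A : JobSequence τ) (S : ℝ → Option (ι × ℕ)) (L : Finset ι) (s : ℝ) : Prop :=
  ∀ i ∈ L, ∀ j : ℕ, (j : ℕ∞) < A.count i → A.release i j < s → A.Finished S i j s

/-- Before any instant there is a last quiet one. -/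
theorem exists_last_quiet (A : JobSequence τ) (S : ℝ → Option (ι × ℕ)) (L : Finset ι) (r : ℝ) :
    ∃ s ≤ r, A.Quiet S L s ∧ ∀ s', s < s' → s' ≤ r → ¬ A.Quiet S L s' := by
  classical
  set Q : Set ℝ := {s | s ≤ r ∧ A.Quiet S L s} with hQ
  have hbdd : BddAbove Q := ⟨r, fun s hs => hs.1⟩
  have hne : Q.Nonempty := by
    -- A time before all first releases of `L` is vacuously quiet.
    obtain ⟨s, hs⟩ : ∃ s, ∀ x ∈ insert r (L.image fun i => A.release i 0), s ≤ x :=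
      (insert r (L.image fun i => A.release i 0)).bddBelow
    refine ⟨s, hs r (Finset.mem_insert_self _ _), fun i hi j hj hlt => ?_⟩
    have h1 := hs (A.release i 0)
      (Finset.mem_insert_of_mem (Finset.mem_image_of_mem (fun i => A.release i 0) hi))
    have h2 := A.release_mono i (Nat.zero_le j) hj
    linarith
  refine ⟨sSup Q, csSup_le hne fun s hs => hs.1, fun i hi j hj hlt => ?_, fun s' h1 h2 h3 => ?_⟩
  -- A job released before the supremum is released before some quiet instant, where it has already
  -- finished.
  · obtain ⟨s, hs, hlt'⟩ := exists_lt_of_lt_csSup hne hlt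
    exact (hs.2 i hi j hj hlt').mono (le_csSup hbdd hs)
  · exact absurd (le_csSup hbdd ⟨h2, h3⟩) (not_le.2 h1)

end JobSequence

/-! ### Recurrence of quiet instants -/

namespace IsFixedPrioritySchedule

variable {ι : Type*} {τ : ι → SporadicTask} {prio : ι → ℕ} {A : JobSequence τ}
  {S : ℝ → Option (ι × ℕ)}

/-- By continuity the service hits `exec` at some `u`; from `u` on the job is finished, hence never
ready and never executed. -/
theorem service_le_exec (hS : IsFixedPrioritySchedule prio A S) {i : ι} {j : ℕ}
    (hj : (j : ℕ∞) < A.count i) (t : ℝ) : A.service S i j t ≤ A.exec i j := by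
  by_contra! hlt
  have hr : A.release i j ≤ t := by
    by_contra! h
    have h1 := A.service_mono S i j h.le
    rw [A.service_release] at h1
    linarith [A.exec_pos i j hj]
  obtain ⟨u, hu, hue⟩ := intermediate_value_Icc hr (A.service_continuous S i j).continuousOn
    (show A.exec i j ∈ Set.Icc _ _ from
      ⟨by rw [A.service_release]; exact (A.exec_pos i j hj).le, hlt.le⟩)
  have hsub : {s : ℝ | S s = some (i, j)} ∩ Set.Ico (A.release i j) t ⊆
      {s : ℝ | S s = some (i, j)} ∩ Set.Ico (A.release i j) u := by
    rintro x ⟨hx, hx1, -⟩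
    refine ⟨hx, hx1, ?_⟩
    by_contra! h
    exact (hS.ready x i j hx).2.2.1 (JobSequence.Finished.mono (a := u) hue.ge h)
  have : A.service S i j t ≤ A.service S i j u :=
    measureReal_mono hsub ((measure_mono Set.inter_subset_right).trans_lt measure_Ico_lt_top).ne
  linarith

/-- If the demand of the tasks of priority at least `p` over a window of length `t` fits into the
window, then a quiet instant is followed by another one at distance at most `t`. -/
theorem exists_next_quiet (hS : IsFixedPrioritySchedule prio A S) {L : Finset ι} {p : ℕ}
    (hL : ∀ i, i ∈ L ↔ prio i ≤ p) {s t : ℝ} (ht : 0 < t)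
    (hdem : ∑ i ∈ L, (⌈t / (τ i).T⌉₊ : ℝ) * (τ i).C ≤ t) (hq : A.Quiet S L s) :
    ∃ s', s < s' ∧ s' ≤ s + t ∧ A.Quiet S L s' := by
  classical
  by_contra! hno
  choose J hJcard hJ using fun i => A.exists_finset_released i s t
  -- With no quiet instant inside, the processor is always busy with jobs of `L`; quietness at `s`
  -- forces these to be released in the window.
  have hcover : Set.Ioo s (s + t) ⊆ ⋃ q ∈ L.sigma J,
      {x : ℝ | S x = some (q.1, q.2)} ∩ Set.Ico (A.release q.1 q.2) (s + t) := by
    rintro x ⟨hx1, hx2⟩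
    have h := hno x hx1 hx2.le
    simp only [JobSequence.Quiet, not_forall] at h
    obtain ⟨i, hi, j, hj, hr, hf⟩ := h
    obtain ⟨j', hready⟩ := JobSequence.exists_ready hj hr.le hf
    obtain ⟨i₁, j₁, hSx, hp⟩ := hS.highest x i j' hready
    obtain ⟨hc, hrel, hnf, -⟩ := hS.ready x i₁ j₁ hSx
    have hi₁ : i₁ ∈ L := (hL i₁).2 (hp.trans ((hL i).1 hi))
    have hs : s ≤ A.release i₁ j₁ := by
      by_contra! h
      exact hnf ((hq i₁ hi₁ j₁ hc h).mono hx1.le)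
    exact Set.mem_biUnion (x := (⟨i₁, j₁⟩ : Σ _ : ι, ℕ))
      (Finset.mem_coe.2 (Finset.mem_sigma.2 ⟨hi₁, (hJ i₁ j₁).2 ⟨hc, hs, hrel.trans_lt hx2⟩⟩))
      ⟨hSx, hrel, hx2⟩
  have hfin : volume (⋃ q ∈ L.sigma J,
      {x : ℝ | S x = some (q.1, q.2)} ∩ Set.Ico (A.release q.1 q.2) (s + t)) ≠ ⊤ := by
    refine (measure_biUnion_lt_top (L.sigma J).finite_toSet fun q _ => ?_).ne
    exact (measure_mono Set.inter_subset_right).trans_lt measure_Ico_lt_top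
  have hserv : t ≤ ∑ q ∈ L.sigma J, A.service S q.1 q.2 (s + t) := by
    calc t = volume.real (Set.Ioo s (s + t)) := by
          rw [Real.volume_real_Ioo_of_le (by linarith)]; ring
      _ ≤ _ := measureReal_mono hcover hfin
      _ ≤ _ := measureReal_biUnion_finset_le _ _
  -- The end of the window is not quiet either: some job is unfinished there, so total service is
  -- strictly below total demand.
  have h := hno (s + t) (by linarith) le_rfl
  simp only [JobSequence.Quiet, not_forall] at h
  obtain ⟨i, hi, j, hj, hr, hf⟩ := h
  have hs : s ≤ A.release i j := by
    by_contra! h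
    exact hf ((hq i hi j hj h).mono (by linarith))
  have hlt : ∑ q ∈ L.sigma J, A.service S q.1 q.2 (s + t) <
      ∑ q ∈ L.sigma J, A.exec q.1 q.2 := by
    refine Finset.sum_lt_sum (fun q hq' => ?_)
      ⟨⟨i, j⟩, Finset.mem_sigma.2 ⟨hi, (hJ i j).2 ⟨hj, hs, hr⟩⟩, not_le.1 hf⟩
    exact hS.service_le_exec ((hJ _ _).1 (Finset.mem_sigma.1 hq').2).1 _
  have hle : ∑ q ∈ L.sigma J, A.exec q.1 q.2 ≤ ∑ i ∈ L, (⌈t / (τ i).T⌉₊ : ℝ) * (τ i).C := by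
    rw [Finset.sum_sigma]
    refine Finset.sum_le_sum fun i _ => ?_
    calc ∑ j ∈ J i, A.exec i j ≤ ∑ _j ∈ J i, (τ i).C :=
          Finset.sum_le_sum fun j hj => A.exec_le i j ((hJ i j).1 hj).1
      _ = (J i).card * (τ i).C := by simp
      _ ≤ _ := mul_le_mul_of_nonneg_right (hJcard i) (τ i).C_pos.le
  linarith

end IsFixedPrioritySchedule

/-! ### Time demand analysis -/

/-- Time demand analysis: a task is schedulable if, for some `t` up to its relative deadline, the
demand of the tasks of at least its priority in a window of length `t` fits into the window. -/
theorem schedulable_of_demand_le {ι : Type*} {τ : ι → SporadicTask} {prio : ι → ℕ} {k : ι}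
    {L : Finset ι} (hL : ∀ i, i ∈ L ↔ prio i ≤ prio k) {t : ℝ} (ht : 0 < t) (htD : t ≤ (τ k).D)
    (hdem : ∑ i ∈ L, (⌈t / (τ i).T⌉₊ : ℝ) * (τ i).C ≤ t) : Schedulable τ prio k := by
  intro A S hS j hj
  obtain ⟨s, hs, hq, hlast⟩ := A.exists_last_quiet S L (A.release k j)
  obtain ⟨s', h1, h2, hq'⟩ := hS.exists_next_quiet hL ht hdem hq
  have h3 : A.release k j < s' := by
    by_contra! h
    exact hlast s' h1 h hq'
  exact (hq' k ((hL k).2 le_rfl) j hj h3).mono (by linarith)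

/-- The demand in a window of length at most `D_k` is at most `C_k'` plus the demand of the tasks
in `hp₁`. -/
theorem sum_ceil_mul_le_virtualC_add {ι : Type*} [Fintype ι] {τ : ι → SporadicTask}
    {prio : ι → ℕ} {k : ι} (hprio : ∀ i : ι, prio i = prio k → i = k) {t : ℝ}
    (ht : 0 < t) (htD : t ≤ (τ k).D) :
    ∑ i ∈ Finset.univ.filter (fun i => prio i ≤ prio k), (⌈t / (τ i).T⌉₊ : ℝ) * (τ i).C ≤
      virtualC τ prio k + ∑ i ∈ hp₁ τ prio k, (⌈t / (τ i).T⌉ : ℝ) * (τ i).C := by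
  classical
  have hcast : ∀ i, (⌈t / (τ i).T⌉₊ : ℝ) = (⌈t / (τ i).T⌉ : ℝ) := fun i =>
    natCast_ceil_eq_intCast_ceil (div_nonneg ht.le (τ i).T_pos.le)
  simp only [hcast]
  have hsplit : Finset.univ.filter (fun i => prio i ≤ prio k) =
      insert k (hp₂ τ prio k ∪ hp₁ τ prio k) := by
    ext i
    simp only [hp₁, hp₂, Finset.mem_filter, Finset.mem_univ, true_and, Finset.mem_insert,
      Finset.mem_union, ← and_or_left]
    constructor
    · intro h
      rcases h.lt_or_eq with h | h
      · exact Or.inr ⟨h, le_or_gt _ _⟩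
      · exact Or.inl (hprio i h)
    · rintro (rfl | h)
      · exact le_rfl
      · exact h.1.le
  have hk : k ∉ hp₂ τ prio k ∪ hp₁ τ prio k := by simp [hp₁, hp₂]
  have hdisj : Disjoint (hp₂ τ prio k) (hp₁ τ prio k) := by
    refine Finset.disjoint_left.2 fun i h2 h1 => ?_
    simp only [hp₁, hp₂, Finset.mem_filter] at h1 h2
    exact absurd h1.2.2 (not_lt.2 h2.2.2)
  rw [hsplit, Finset.sum_insert hk, Finset.sum_union hdisj, virtualC, ← add_assoc]
  gcongr with i hi
  · exact (τ k).C_pos.le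
  · exact (τ k).T_pos.le
  -- Since `t ≤ D_k ≤ T_i`, a task of `hp₂` contributes at most one job.
  · have h : t / (τ i).T ≤ 1 := by
      rw [div_le_one (τ i).T_pos]
      simp only [hp₂, Finset.mem_filter] at hi
      exact htD.trans hi.2.2
    have h1 : ⌈t / (τ i).T⌉ ≤ 1 := Int.ceil_le.2 (by exact_mod_cast h)
    have h2 : (⌈t / (τ i).T⌉ : ℝ) ≤ 1 := by exact_mod_cast h1
    exact mul_le_of_le_one_left (τ i).C_pos.le h2

/-! ### The quadratic test -/

/-- The linear-arithmetic core of the quadratic bound: if the demand inequality fails at all of the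
test points `x a` and at `D`, then the quadratic schedulability test fails. -/
theorem lt_of_forall_testPoint_lt {m : ℕ} {U C x : Fin m → ℝ} {c D : ℝ} (hU : ∀ a, 0 ≤ U a)
    (hC : ∀ a, 0 ≤ C a) (hc : 0 < c) (hD : ∑ a, C a ≤ D)
    (hx : ∀ a, x a ≤ c + ∑ b, U b * x b + ∑ b ∈ Finset.Iio a, C b)
    (hend : D < c + ∑ b, U b * x b + ∑ b, C b) :
    D - D * ∑ a, U a - ∑ a, C a + ∑ a, U a * ∑ l ∈ Finset.Ici a, C l < c := by
  by_contra! hle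
  set X := c + ∑ b, U b * x b with hX
  have hIci : ∀ a, ∑ l ∈ Finset.Ici a, C l = ∑ l, C l - ∑ l ∈ Finset.Iio a, C l := by
    intro a
    rw [eq_sub_iff_add_eq, ← Finset.sum_union (Finset.disjoint_left.2 fun b h1 h2 => ?_)]
    · congr 1
      ext b
      simpa using le_or_gt a b
    · exact absurd (Finset.mem_Iio.1 h2) (not_lt.2 (Finset.mem_Ici.1 h1))
  set V := ∑ a, U a * ∑ l ∈ Finset.Iio a, C l with hV
  have hsum : ∑ a, U a * ∑ l ∈ Finset.Ici a, C l = (∑ a, U a) * ∑ l, C l - V := by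
    simp only [hIci, mul_sub, Finset.sum_sub_distrib, hV, Finset.sum_mul]
  -- Weighting the test-point inequalities by `U a` gives `X - c ≤ (∑ U) X + V`.
  have hUx : ∑ a, U a * x a ≤ (∑ a, U a) * X + V := by
    rw [hV, Finset.sum_mul, ← Finset.sum_add_distrib]
    refine Finset.sum_le_sum fun a _ => ?_
    rw [← mul_add]
    exact mul_le_mul_of_nonneg_left (hx a) (hU a)
  have hVnonneg : 0 ≤ V := Finset.sum_nonneg fun a _ =>
    mul_nonneg (hU a) (Finset.sum_nonneg fun l _ => hC l)
  rw [hsum] at hle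
  -- The negated goal reads `c + V ≤ (D - ∑ C)(1 - ∑ U)`. Once `1 - ∑ U` is positive, `D - ∑ C < X`
  -- makes the right side less than `X (1 - ∑ U) ≤ c + V`.
  have h1 : 0 < (D - ∑ a, C a) * (1 - ∑ a, U a) := by nlinarith
  have h2 : 0 < 1 - ∑ a, U a := pos_of_mul_pos_right h1 (by linarith)
  nlinarith

theorem virtualC_pos {ι : Type*} [Fintype ι] (τ : ι → SporadicTask) (prio : ι → ℕ) (k : ι) :
    0 < virtualC τ prio k := by
  have h : 0 < (⌈(τ k).D / (τ k).T⌉ : ℝ) :=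
    Int.cast_pos.2 (Int.ceil_pos.2 (div_pos (τ k).D_pos (τ k).T_pos))
  exact add_pos_of_pos_of_nonneg (mul_pos h (τ k).C_pos)
    (Finset.sum_nonneg fun i _ => (τ i).C_pos.le)

theorem lastRelease_lt {ι : Type*} (τ : ι → SporadicTask) (k i : ι) :
    lastRelease τ k i < (τ k).D := by
  have h := Int.ceil_lt_add_one ((τ k).D / (τ i).T)
  rw [lastRelease, ← lt_div_iff₀ (τ i).T_pos]
  linarith

/-- This is where `T_i < D_k` matters: only positive test points are admissible window lengths. -/
theorem lastRelease_pos {ι : Type*} {τ : ι → SporadicTask} {k i : ι} (h : (τ i).T < (τ k).D) :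
    0 < lastRelease τ k i := by
  have h1 : 1 < (τ k).D / (τ i).T := (one_lt_div (τ i).T_pos).2 h
  exact mul_pos (by linarith [Int.le_ceil ((τ k).D / (τ i).T)]) (τ i).T_pos

/-- The product counts all but the last of the `⌈D_k / T_i⌉` jobs. -/
theorem U_mul_lastRelease {ι : Type*} (τ : ι → SporadicTask) (k i : ι) :
    (τ i).U * lastRelease τ k i = ((⌈(τ k).D / (τ i).T⌉ : ℝ) - 1) * (τ i).C := by
  have := (τ i).T_pos.ne'
  rw [SporadicTask.U, lastRelease]
  field_simp

/-- Up to the deadline, the demand of a task is at most `U_i t_i + C_i`. -/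
theorem ceil_mul_le_add {ι : Type*} (τ : ι → SporadicTask) (k i : ι) {t : ℝ}
    (ht : t ≤ (τ k).D) :
    (⌈t / (τ i).T⌉ : ℝ) * (τ i).C ≤ (τ i).U * lastRelease τ k i + (τ i).C := by
  have h : (⌈t / (τ i).T⌉ : ℝ) ≤ ⌈(τ k).D / (τ i).T⌉ :=
    Int.cast_le.2 (Int.ceil_mono (div_le_div_of_nonneg_right ht (τ i).T_pos.le))
  rw [U_mul_lastRelease]
  nlinarith [(τ i).C_pos]

/-- Up to the last release before the deadline, the demand of a task is at most `U_i t_i`. -/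
theorem ceil_mul_le {ι : Type*} (τ : ι → SporadicTask) (k i : ι) {t : ℝ}
    (ht : t ≤ lastRelease τ k i) :
    (⌈t / (τ i).T⌉ : ℝ) * (τ i).C ≤ (τ i).U * lastRelease τ k i := by
  have h : ⌈t / (τ i).T⌉ ≤ ⌈(τ k).D / (τ i).T⌉ - 1 := by
    rw [Int.ceil_le, div_le_iff₀ (τ i).T_pos]
    push_cast
    exact ht
  have h' : (⌈t / (τ i).T⌉ : ℝ) ≤ (⌈(τ k).D / (τ i).T⌉ : ℝ) - 1 := by exact_mod_cast h
  rw [U_mul_lastRelease]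
  exact mul_le_mul_of_nonneg_right h' (τ i).C_pos.le

theorem theorem1 {ι : Type*} [Fintype ι] (τ : ι → SporadicTask) (prio : ι → ℕ) (k : ι)
    (hprio : ∀ i : ι, prio i = prio k → i = k)
    (m : ℕ) (σ : Fin m ≃ {i : ι // i ∈ hp₁ τ prio k})
    (hσ : Monotone fun a : Fin m => lastRelease τ k (σ a))
    (hload : ∑ a : Fin m, (τ (σ a)).C / (τ k).D ≤ 1)
    (htest : virtualC τ prio k / (τ k).D ≤
      1 - ∑ a : Fin m, (τ (σ a)).U - ∑ a : Fin m, (τ (σ a)).C / (τ k).D +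
        (∑ a : Fin m, (τ (σ a)).U * ∑ l ∈ Finset.Ici a, (τ (σ l)).C) / (τ k).D) :
    Schedulable τ prio k := by
  have hDpos := (τ k).D_pos
  have hmem : ∀ a, (τ (σ a)).T < (τ k).D := fun a => (Finset.mem_filter.1 (σ a).2).2.2
  by_contra hns
  have hfail : ∀ t, 0 < t → t ≤ (τ k).D →
      t < virtualC τ prio k + ∑ a, (⌈t / (τ (σ a)).T⌉ : ℝ) * (τ (σ a)).C := by
    intro t ht htD
    by_contra! hle
    refine hns (schedulable_of_demand_le (L := Finset.univ.filter fun i => prio i ≤ prio k)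
      (by simp) ht htD ((sum_ceil_mul_le_virtualC_add hprio ht htD).trans ?_))
    rwa [← Finset.sum_coe_sort, ← Equiv.sum_comp σ]
  have hlt := lt_of_forall_testPoint_lt (U := fun a => (τ (σ a)).U) (C := fun a => (τ (σ a)).C)
    (x := fun a => lastRelease τ k (σ a)) (c := virtualC τ prio k) (D := (τ k).D)
    (fun a => (div_pos (τ (σ a)).C_pos (τ (σ a)).T_pos).le) (fun a => (τ (σ a)).C_pos.le)
    (virtualC_pos τ prio k)
    (by rwa [← Finset.sum_div, div_le_one hDpos] at hload)
    (fun a => by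
      refine ((hfail _ (lastRelease_pos (hmem a)) (lastRelease_lt τ k _).le).le).trans ?_
      have hIio : ∑ b ∈ Finset.Iio a, (τ (σ b)).C = ∑ b, if b < a then (τ (σ b)).C else 0 := by
        rw [← Finset.sum_filter]
        congr 1
        ext b
        simp
      rw [add_assoc, hIio, ← Finset.sum_add_distrib]
      gcongr with b
      -- Tasks before `a` may pay for their last job as well; by monotonicity the others have their
      -- last release no earlier than `t_a` and do not.
      split_ifs with h
      · exact ceil_mul_le_add τ k _ (lastRelease_lt τ k _).le
      · rw [add_zero]
        exact ceil_mul_le τ k _ (hσ (not_lt.1 h)))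
    (by
      refine (hfail _ hDpos le_rfl).trans_le ?_
      rw [add_assoc, ← Finset.sum_add_distrib]
      gcongr with b
      exact ceil_mul_le_add τ k _ le_rfl)
  rw [← Finset.sum_div, div_le_iff₀ hDpos] at htest
  have hexp : (1 - ∑ a, (τ (σ a)).U - (∑ a, (τ (σ a)).C) / (τ k).D +
      (∑ a, (τ (σ a)).U * ∑ l ∈ Finset.Ici a, (τ (σ l)).C) / (τ k).D) * (τ k).D =
      (τ k).D - (τ k).D * ∑ a, (τ (σ a)).U - ∑ a, (τ (σ a)).C +
        ∑ a, (τ (σ a)).U * ∑ l ∈ Finset.Ici a, (τ (σ l)).C := by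
    field_simp
  rw [hexp] at htest
  exact absurd hlt (not_lt.2 htest)
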